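/- Let $k\in\mathbb{N}$. A discrete multiple set in $\mathbb{R}^k$ is the family of values $D=\{a_n\}_{n\in\mathbb{N}}$ (counted with multiplicity) of an infinite sequence $(a_n)_{n\in\mathbb{N}}\subset\mathbb{R}^k$ that has no finite limit point (a value taken infinitely often counts as a limit point). For two such sets put $$\mathrm{dist}(\{a_n\},\{b_n\})=\inf_{\sigma}\ \sup_{n\in\mathbb{N}}|a_n-b_{\sigma(n)}|\in[0,\infty],$$ the infimum being over all bijections $\sigma:\mathbb{N}\to\mathbb{N}$. A set $E\subset\mathbb{R}^k$ is relatively dense if for some $L<\infty$ every ball of radius $L$ meets $E$. The set $D$ is almost periodic if for every $\varepsilon>0$ the set of all $\tau\in\mathbb{R}^k$ with $\mathrm{dist}(\{a_n\},\{a_n+\tau\})<\varepsilon$ is relatively dense. A continuous function $g:\mathbb{R}^k\to\mathbb{C}$ is almost periodic if for every $\varepsilon>0$ the set of all $\tau\in\mathbb{R}^k$ with $|g(x-\tau)-g(x)|<\varepsilon$ for all $x\in\mathbb{R}^k$ is relatively dense. A locally finite measure $\mu$ on $\mathbb{R}^k$ is almost periodic if for every compactly supported continuous function $\varphi:\mathbb{R}^k\to\mathbb{C}$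 the function $z\mapsto\int_{\mathbb{R}^k}\varphi(y-z)\,d\mu(y)$ is almost periodic. Theorem. A discrete multiple set $D=\{a_n\}_{n\in\mathbb{N}}\subset\mathbb{R}^k$ is almost periodic if and only if the measure $\mu_D=\sum_{n\in\mathbb{N}}\delta_{a_n}$ is almost periodic. -/

import Mathlib

open MeasureTheory Filter Topology
open scoped ENNReal

/-- `E ⊆ ℝᵏ` is relatively dense: for some finite `L`, every open ball of radius `L` meets `E`. -/
def RelativelyDense {k : ℕ} (E : Set (EuclideanSpace ℝ (Fin k))) : Prop :=
  ∃ L : ℝ, ∀ c : EuclideanSpace ℝ (Fin k), (Metric.ball c L ∩ E).Nonempty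

/-- `τ` is an `ε`-almost period of the mapping `g`. -/
def IsAlmostPeriodOfMap {k : ℕ} {F : Type*} [NormedAddCommGroup F]
    (g : EuclideanSpace ℝ (Fin k) → F) (ε : ℝ) (τ : EuclideanSpace ℝ (Fin k)) : Prop :=
  ∀ x, ‖g (x - τ) - g x‖ < ε

/-- Almost periodic (continuous) mappings on `ℝᵏ`. -/
def IsAlmostPeriodicMap {k : ℕ} {F : Type*} [NormedAddCommGroup F]
    (g : EuclideanSpace ℝ (Fin k) → F) : Prop :=
  Continuous g ∧ ∀ ε : ℝ, 0 < ε → RelativelyDense {τ | IsAlmostPeriodOfMap g ε τ}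

/-- The sequence `a` represents a discrete multiple set: it has no finite limit point (limit point
of a sequence, so that a value taken infinitely often is one). -/
def IsDiscreteMultipleSet {k : ℕ} (a : ℕ → EuclideanSpace ℝ (Fin k)) : Prop :=
  ∀ x, ¬ MapClusterPt x atTop a

/-- The bijection-matching distance `inf_σ sup_n |a_n - b_{σ(n)}|`, possibly `∞`. -/
noncomputable def matchingDist {k : ℕ} (a b : ℕ → EuclideanSpace ℝ (Fin k)) : ℝ≥0∞ :=
  ⨅ σ : Equiv.Perm ℕ, ⨆ n : ℕ, edist (a n) (b (σ n))

/-- `τ` is an `ε`-almost period of the multiple set `{a_n}`. -/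
def IsAlmostPeriodOfMultipleSet {k : ℕ} (a : ℕ → EuclideanSpace ℝ (Fin k)) (ε : ℝ)
    (τ : EuclideanSpace ℝ (Fin k)) : Prop :=
  matchingDist a (fun n => a n + τ) < ENNReal.ofReal ε

/-- Almost periodic multiple sets. -/
def IsAlmostPeriodicMultipleSet {k : ℕ} (a : ℕ → EuclideanSpace ℝ (Fin k)) : Prop :=
  ∀ ε : ℝ, 0 < ε → RelativelyDense {τ | IsAlmostPeriodOfMultipleSet a ε τ}

/-- The counting measure `∑ₙ δ_{a_n}`. -/
noncomputable def countingMeasure {k : ℕ} (a : ℕ → EuclideanSpace ℝ (Fin k)) :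
    Measure (EuclideanSpace ℝ (Fin k)) :=
  Measure.sum fun n => Measure.dirac (a n)

/-- The convolution `z ↦ ∫ φ(y - z) dμ(y)` of a test function with a measure. -/
noncomputable def measureConvolution {k : ℕ} (φ : EuclideanSpace ℝ (Fin k) → ℂ)
    (μ : Measure (EuclideanSpace ℝ (Fin k))) (z : EuclideanSpace ℝ (Fin k)) : ℂ :=
  ∫ y, φ (y - z) ∂μ

/-- Almost periodic (nonnegative) measures on `ℝᵏ`: locally finite (so automatically Radon), and
every convolution with a compactly supported continuous function is almost periodic. -/
def IsAlmostPeriodicMeasure {k : ℕ} (μ : Measure (EuclideanSpace ℝ (Fin k))) : Prop :=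
  IsLocallyFiniteMeasure μ ∧
    ∀ φ : EuclideanSpace ℝ (Fin k) → ℂ, Continuous φ → HasCompactSupport φ →
      IsAlmostPeriodicMap (measureConvolution φ μ)

/-!
Let `g_φ z = ∑ₙ φ (a n - z)` be the convolution of the counting measure with a test function `φ`.

If the multiple set is almost periodic, the number of its points in a ball is bounded in terms of
the radius. A `δ`-almost period `τ` provides a bijection moving every point by less than `δ`, so
`g_φ (z - τ)` and `g_φ z` differ by at most the oscillation of `φ` at scale `δ` times a bounded
number of terms (`norm_tsum_sub_tsum_le`).

For the converse, boundedness of almost periodic maps bounds the number of points in any ball of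
radius `ε` by some `M`. Consider the radii `r_j = ε / 4 ^ (j + 1)`, `j ≤ M`, and the plateau
functions that are `1` for `‖x‖ ≤ r_j` and `0` for `‖x‖ ≥ 2 r_j`. Their convolutions have a
relatively dense set of common `1`-almost periods (`relativelyDense_common_almostPeriods`), and for
such a `τ` every ball `B(z, 2 r_j)` contains at least as many points of the translate `a + τ` as
`B(z, r_j)` contains points of `a`, because counts are integers. By the pigeonhole principle every
`a n` has some `j` for which the annulus `r_j < ‖x - a n‖ < 4 r_j` is free of points
(`exists_empty_annulus`). These annuli separate the points into clusters with disjoint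
neighbourhoods, which gives Hall's condition (`exists_injective_dist_lt`) and hence an injection of
`a` into `a + τ` moving points by at most `ε / 2`. As `-τ` is an almost period as well, there is
such an injection in the opposite direction, and the Schröder–Bernstein construction combines the
two into a bijection with the same bound.
-/

/-! ### Almost periodic maps -/

lemma IsAlmostPeriodOfMap.neg {k : ℕ} {F : Type*} [NormedAddCommGroup F]
    {g : EuclideanSpace ℝ (Fin k) → F} {ε : ℝ} {τ : EuclideanSpace ℝ (Fin k)}
    (h : IsAlmostPeriodOfMap g ε τ) : IsAlmostPeriodOfMap g ε (-τ) := by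
  intro x
  have := h (x + τ)
  rw [add_sub_cancel_right, norm_sub_rev] at this
  simpa using this

lemma RelativelyDense.mono {k : ℕ} {s t : Set (EuclideanSpace ℝ (Fin k))}
    (hs : RelativelyDense s) (hst : s ⊆ t) : RelativelyDense t := by
  obtain ⟨L, hL⟩ := hs
  exact ⟨L, fun c => (hL c).mono (Set.inter_subset_inter_right _ hst)⟩

lemma IsAlmostPeriodicMap.exists_norm_le {k : ℕ} {F : Type*} [NormedAddCommGroup F]
    {g : EuclideanSpace ℝ (Fin k) → F} (hg : IsAlmostPeriodicMap g) :
    ∃ C : ℝ, ∀ x, ‖g x‖ ≤ C := by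
  obtain ⟨L, hL⟩ := hg.2 1 one_pos
  obtain ⟨C, hC⟩ :=
    (isCompact_closedBall (0 : EuclideanSpace ℝ (Fin k)) L).exists_bound_of_continuousOn
      hg.1.continuousOn
  refine ⟨C + 1, fun x => ?_⟩
  obtain ⟨τ, hτL, hτ⟩ := hL x
  have h1 := hC (x - τ) (by
    rw [mem_closedBall_zero_iff, ← dist_eq_norm, dist_comm]; exact (Metric.mem_ball.1 hτL).le)
  have h2 := hτ x
  have h3 := norm_sub_norm_le (g x) (g (x - τ))
  rw [norm_sub_rev] at h3
  linarith

lemma IsAlmostPeriodicMap.uniformContinuous {k : ℕ} {F : Type*} [NormedAddCommGroup F]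
    {g : EuclideanSpace ℝ (Fin k) → F} (hg : IsAlmostPeriodicMap g) : UniformContinuous g := by
  rw [Metric.uniformContinuous_iff]
  intro ε hε
  obtain ⟨L, hL⟩ := hg.2 (ε / 3) (by positivity)
  have huc := (isCompact_closedBall (0 : EuclideanSpace ℝ (Fin k))
    (L + 1)).uniformContinuousOn_of_continuous hg.1.continuousOn
  rw [Metric.uniformContinuousOn_iff] at huc
  obtain ⟨δ, hδ, hgδ⟩ := huc (ε / 3) (by positivity)
  refine ⟨min δ 1, by positivity, fun {x y} hxy => ?_⟩
  obtain ⟨τ, hτL, hτ⟩ := hL x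
  rw [Metric.mem_ball, dist_comm] at hτL
  have hx : dist (x - τ) 0 < L := by rwa [dist_zero_right, ← dist_eq_norm]
  have hyx : dist (x - τ) (y - τ) < min δ 1 := by rwa [dist_sub_right]
  have hy : dist (y - τ) 0 < L + 1 := by
    have := dist_triangle_left (y - τ) 0 (x - τ)
    have := hyx.trans_le (min_le_right _ _)
    linarith
  have h1 := hgδ (x - τ) (Metric.mem_closedBall.2 (by linarith)) (y - τ)
    (Metric.mem_closedBall.2 hy.le) (hyx.trans_le (min_le_left _ _))
  have h2 := hτ x
  have h3 := hτ y
  rw [← dist_eq_norm] at h2 h3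
  rw [dist_comm] at h2
  linarith [dist_triangle4 (g x) (g (x - τ)) (g (y - τ)) (g y)]

/-- Bochner's precompactness of the set of translates, in the form of a finite colouring of `ℝᵏ`:
translates by vectors of the same colour are uniformly `ε`-close. -/
lemma IsAlmostPeriodicMap.exists_finite_colouring {k : ℕ} {F : Type*} [NormedAddCommGroup F]
    {g : EuclideanSpace ℝ (Fin k) → F} (hg : IsAlmostPeriodicMap g) {ε : ℝ} (hε : 0 < ε) :
    ∃ (t : Set (EuclideanSpace ℝ (Fin k)))
      (c : EuclideanSpace ℝ (Fin k) → EuclideanSpace ℝ (Fin k)),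
      t.Finite ∧ (∀ h, c h ∈ t) ∧ ∀ h h', c h = c h' → ∀ x, ‖g (x - h) - g (x - h')‖ < ε := by
  obtain ⟨L, hL⟩ := hg.2 (ε / 4) (by positivity)
  obtain ⟨δ, hδ, hgδ⟩ := Metric.uniformContinuous_iff.1 hg.uniformContinuous (ε / 4) (by positivity)
  obtain ⟨t, -, htf, ht⟩ := finite_cover_balls_of_compact
    (isCompact_closedBall (0 : EuclideanSpace ℝ (Fin k)) L) hδ
  choose τ hτL hτ using hL
  -- Every `h` is an almost period `τ h` plus a vector of bounded length, and the latter is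
  -- rounded to the net `t` to give the colour.
  have hcol : ∀ h, ∃ y ∈ t, dist (h - τ h) y < δ := by
    intro h
    have : h - τ h ∈ Metric.closedBall (0 : EuclideanSpace ℝ (Fin k)) L := by
      rw [mem_closedBall_zero_iff, ← dist_eq_norm, dist_comm]
      exact (Metric.mem_ball.1 (hτL h)).le
    simpa using ht this
  choose c hct hc using hcol
  refine ⟨t, c, htf, hct, fun h h' hcc x => ?_⟩
  have key : ∀ h, dist (g (x - h)) (g (x - c h)) < ε / 2 := by
    intro h
    have h1 := hτ h (x - (h - τ h))
    rw [← dist_eq_norm, sub_sub, sub_add_cancel] at h1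
    have h2 : dist (g (x - (h - τ h))) (g (x - c h)) < ε / 4 :=
      hgδ (by rw [dist_sub_left]; exact hc h)
    linarith [dist_triangle (g (x - h)) (g (x - (h - τ h))) (g (x - c h))]
  rw [← dist_eq_norm]
  have h1 := key h
  have h2 := key h'
  rw [← hcc] at h2
  linarith [dist_triangle_right (g (x - h)) (g (x - h')) (g (x - c h))]

/-- Finitely many almost periodic maps have a relatively dense set of common almost periods. -/
lemma relativelyDense_common_almostPeriods {k : ℕ} {F ι : Type*} [NormedAddCommGroup F] [Finite ι]
    {g : ι → EuclideanSpace ℝ (Fin k) → F} (hg : ∀ i, IsAlmostPeriodicMap (g i)) {ε : ℝ}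
    (hε : 0 < ε) : RelativelyDense {τ | ∀ i, IsAlmostPeriodOfMap (g i) ε τ} := by
  choose t c htf hct hc using fun i => (hg i).exists_finite_colouring hε
  -- All colours are read off together; one representative of each joint colour is fixed.
  let C : EuclideanSpace ℝ (Fin k) → ι → EuclideanSpace ℝ (Fin k) := fun h i => c i h
  have hfin : (Set.range C).Finite :=
    (Set.Finite.pi' htf).subset (by rintro _ ⟨h, rfl⟩ i; exact hct i h)
  let rep := Function.invFun C
  have hrep : ∀ h, C (rep (C h)) = C h := fun h => Function.invFun_eq ⟨h, rfl⟩
  obtain ⟨L, hL⟩ := (hfin.image rep).isBounded.exists_norm_le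
  refine ⟨L + 1, fun h => ⟨h - rep (C h), ?_, fun i x => ?_⟩⟩
  · have := hL (rep (C h)) ⟨C h, ⟨h, rfl⟩, rfl⟩
    rw [Metric.mem_ball, dist_eq_norm, sub_sub_cancel_left, norm_neg]
    linarith
  · have := hc i h (rep (C h)) (congrFun (hrep h) i).symm (x + rep (C h))
    rwa [add_sub_cancel_right, show x + rep (C h) - h = x - (h - rep (C h)) by abel] at this

/-! ### Counting measures of discrete multiple sets -/

lemma IsDiscreteMultipleSet.finite_dist_le {k : ℕ} {a : ℕ → EuclideanSpace ℝ (Fin k)}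
    (ha : IsDiscreteMultipleSet a) (c : EuclideanSpace ℝ (Fin k)) (R : ℝ) :
    {n | dist (a n) c ≤ R}.Finite := by
  by_contra h
  obtain ⟨x, -, hx⟩ := (isCompact_closedBall c R).exists_mapClusterPt_of_frequently
    (Nat.frequently_atTop_iff_infinite.2 h)
  exact ha x hx

lemma IsDiscreteMultipleSet.finite_dist_lt {k : ℕ} {a : ℕ → EuclideanSpace ℝ (Fin k)}
    (ha : IsDiscreteMultipleSet a) (c : EuclideanSpace ℝ (Fin k)) (R : ℝ) :
    {n | dist (a n) c < R}.Finite :=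
  (ha.finite_dist_le c R).subset fun n hn => by
    rw [Set.mem_ofPred_eq] at hn ⊢
    exact hn.le

lemma IsDiscreteMultipleSet.isLocallyFiniteMeasure {k : ℕ} {a : ℕ → EuclideanSpace ℝ (Fin k)}
    (ha : IsDiscreteMultipleSet a) : IsLocallyFiniteMeasure (countingMeasure a) := by
  refine ⟨fun x => ⟨Metric.ball x 1, Metric.ball_mem_nhds x one_pos, ?_⟩⟩
  have hfin := ha.finite_dist_lt x 1
  rw [countingMeasure, Measure.sum_apply _ Metric.isOpen_ball.measurableSet,
    tsum_eq_sum (s := hfin.toFinset)]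
  · exact ENNReal.sum_lt_top.2 fun n _ => measure_lt_top _ _
  · intro n hn
    rw [Measure.dirac_apply' _ Metric.isOpen_ball.measurableSet]
    simpa using hn

lemma IsDiscreteMultipleSet.measureConvolution_eq_tsum {k : ℕ}
    {a : ℕ → EuclideanSpace ℝ (Fin k)} (ha : IsDiscreteMultipleSet a)
    {φ : EuclideanSpace ℝ (Fin k) → ℂ} (hφ : Continuous φ) (hc : HasCompactSupport φ)
    (z : EuclideanSpace ℝ (Fin k)) :
    measureConvolution φ (countingMeasure a) z = ∑' n, φ (a n - z) := by
  have := ha.isLocallyFiniteMeasure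
  have hint : Integrable (fun y => φ (y - z)) (countingMeasure a) :=
    (hφ.comp (continuous_id.sub continuous_const)).integrable_of_hasCompactSupport
      (hc.comp_homeomorph (Homeomorph.subRight z))
  rw [measureConvolution, countingMeasure]
  rw [countingMeasure] at hint
  rw [← (hasSum_integral_measure hint).tsum_eq]
  simp only [integral_dirac]

/-- The number of indices `n` with `a n` in a given ball is bounded in terms of the radius alone. -/
def HasBoundedCounts {k : ℕ} (a : ℕ → EuclideanSpace ℝ (Fin k)) : Prop :=
  ∀ R : ℝ, ∃ M : ℕ, ∀ c, {n | dist (a n) c ≤ R}.encard ≤ M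

/-! ### Almost periodic multiple sets have almost periodic counting measures -/

lemma IsAlmostPeriodOfMultipleSet.exists_perm {k : ℕ} {a : ℕ → EuclideanSpace ℝ (Fin k)} {ε : ℝ}
    {τ : EuclideanSpace ℝ (Fin k)} (h : IsAlmostPeriodOfMultipleSet a ε τ) :
    ∃ σ : Equiv.Perm ℕ, ∀ n, dist (a n) (a (σ n) + τ) < ε := by
  obtain ⟨σ, hσ⟩ := iInf_lt_iff.1 h
  refine ⟨σ, fun n => ?_⟩
  have := (le_iSup (fun n => edist (a n) (a (σ n) + τ)) n).trans_lt hσ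
  rw [edist_dist] at this
  exact (ENNReal.ofReal_lt_ofReal_iff_of_nonneg dist_nonneg).1 this

lemma isAlmostPeriodOfMultipleSet_of_perm {k : ℕ} {a : ℕ → EuclideanSpace ℝ (Fin k)} {δ ε : ℝ}
    (hε : 0 < ε) (hδε : δ < ε) {τ : EuclideanSpace ℝ (Fin k)} (σ : Equiv.Perm ℕ)
    (hσ : ∀ n, dist (a n) (a (σ n) + τ) ≤ δ) : IsAlmostPeriodOfMultipleSet a ε τ := by
  refine (iInf_le _ σ).trans_lt (lt_of_le_of_lt ?_ ((ENNReal.ofReal_lt_ofReal_iff hε).2 hδε))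
  exact iSup_le fun n => by rw [edist_dist]; exact ENNReal.ofReal_le_ofReal (hσ n)

/-- A `1`-almost period moves every ball near the origin without losing points of the multiple
set, so that the counts are bounded by the count in one ball centred at the origin. -/
lemma IsAlmostPeriodicMultipleSet.hasBoundedCounts {k : ℕ} {a : ℕ → EuclideanSpace ℝ (Fin k)}
    (ha : IsDiscreteMultipleSet a) (hap : IsAlmostPeriodicMultipleSet a) :
    HasBoundedCounts a := by
  intro R
  obtain ⟨L, hL⟩ := hap 1 one_pos
  refine ⟨{n | dist (a n) 0 ≤ R + L + 1}.ncard, fun c => ?_⟩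
  obtain ⟨τ, hτL, hτ⟩ := hL c
  obtain ⟨σ, hσ⟩ := hτ.exists_perm
  rw [(ha.finite_dist_le 0 (R + L + 1)).cast_ncard_eq]
  refine Set.encard_le_encard_of_injOn (f := σ) (fun n hn => ?_) σ.injective.injOn
  have h1 := hσ n
  have h2 : dist (a n) c ≤ R := hn
  have h3 : dist τ c < L := hτL
  have h4 : dist (a (σ n)) 0 = dist (a (σ n) + τ) τ := by simp [dist_eq_norm]
  change dist (a (σ n)) 0 ≤ R + L + 1
  rw [h4]
  rw [dist_comm] at h1
  rw [dist_comm] at h3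
  linarith [dist_triangle4 (a (σ n) + τ) (a n) c τ]

/-- Moving each point by at most `δ` changes a sum of values of a compactly supported test function
by at most the oscillation at scale `δ` times the number of points near the support. -/
lemma norm_tsum_sub_tsum_le {E F : Type*} [PseudoMetricSpace E] [NormedAddCommGroup F]
    {φ : E → F} {c : E} {R δ ω : ℝ} {M : ℕ} (hsupp : ∀ x, R < dist x c → φ x = 0) {p q : ℕ → E}
    (hω : ∀ x y, dist x y ≤ δ → ‖φ x - φ y‖ ≤ ω) (hpq : ∀ n, dist (p n) (q n) ≤ δ)
    (hM : {n | dist (p n) c ≤ R + δ}.encard ≤ M) :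
    ‖∑' n, φ (p n) - ∑' n, φ (q n)‖ ≤ M * ω := by
  have hfin : {n | dist (p n) c ≤ R + δ}.Finite := Set.finite_of_encard_le_coe hM
  have hδ : 0 ≤ δ := dist_nonneg.trans (hpq 0)
  have hω0 : 0 ≤ ω := (norm_nonneg _).trans (hω (p 0) (q 0) (hpq 0))
  have hcard : hfin.toFinset.card ≤ M := by
    rw [hfin.encard_eq_coe_toFinset_card] at hM
    exact_mod_cast hM
  have hfar : ∀ n ∉ hfin.toFinset, R + δ < dist (p n) c := fun n hn => by simpa using hn
  rw [tsum_eq_sum (s := hfin.toFinset) fun n hn => hsupp _ (by linarith [hfar n hn]),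
    tsum_eq_sum (s := hfin.toFinset) fun n hn => hsupp _ (by
      linarith [hfar n hn, hpq n, dist_triangle (p n) (q n) c]), ← Finset.sum_sub_distrib]
  calc _ ≤ ∑ n ∈ hfin.toFinset, ω := norm_sum_le_of_le _ fun n _ => hω _ _ (hpq n)
    _ = hfin.toFinset.card * ω := by rw [Finset.sum_const, nsmul_eq_mul]
    _ ≤ M * ω := by gcongr

theorem IsAlmostPeriodicMultipleSet.isAlmostPeriodicMeasure {k : ℕ}
    {a : ℕ → EuclideanSpace ℝ (Fin k)} (ha : IsDiscreteMultipleSet a)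
    (hap : IsAlmostPeriodicMultipleSet a) : IsAlmostPeriodicMeasure (countingMeasure a) := by
  refine ⟨ha.isLocallyFiniteMeasure, fun φ hφ hc => ?_⟩
  obtain ⟨R, hR⟩ := hc.isCompact.isBounded.subset_closedBall 0
  have hsupp : ∀ x, R < dist x 0 → φ x = 0 := fun x hx => by
    by_contra hne
    exact hx.not_ge (hR (subset_tsupport φ hne))
  obtain ⟨M, hM⟩ := hap.hasBoundedCounts ha (R + 1)
  have huc := Metric.uniformContinuous_iff.1 (hc.uniformContinuous_of_continuous hφ)
  have hMz : ∀ z δ, δ ≤ 1 → {n | dist (a n - z) 0 ≤ R + δ}.encard ≤ M := fun z δ hδ =>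
    (Set.encard_le_encard fun n hn => by
      rw [Set.mem_ofPred_eq, dist_zero_right, ← dist_eq_norm] at hn
      rw [Set.mem_ofPred_eq]
      linarith).trans (hM z)
  have modulus : ∀ ε > 0, ∃ δ > 0, δ ≤ 1 ∧ ∀ z (q : ℕ → EuclideanSpace ℝ (Fin k)),
      (∀ n, dist (a n - z) (q n) ≤ δ) → ‖∑' n, φ (a n - z) - ∑' n, φ (q n)‖ < ε := by
    intro ε hε
    obtain ⟨δ, hδ, hφδ⟩ := huc (ε / (M + 1)) (by positivity)
    refine ⟨min (δ / 2) 1, by positivity, min_le_right _ _, fun z q hq => ?_⟩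
    refine (norm_tsum_sub_tsum_le hsupp (ω := ε / (M + 1)) (fun x y hxy => ?_) hq
      (hMz z _ (min_le_right _ _))).trans_lt ?_
    · rw [← dist_eq_norm]
      exact (hφδ (by linarith [min_le_left (δ / 2) 1])).le
    · rw [← mul_div_assoc, div_lt_iff₀ (by positivity)]
      linarith
  have hconv := ha.measureConvolution_eq_tsum hφ hc
  refine ⟨Metric.continuous_iff.2 fun z ε hε => ?_, fun ε hε => ?_⟩
  · obtain ⟨δ, hδ, -, h⟩ := modulus ε hε
    refine ⟨δ, hδ, fun w hw => ?_⟩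
    rw [dist_eq_norm, hconv, hconv]
    exact h w _ fun n => by rw [dist_sub_left]; exact hw.le
  · obtain ⟨δ, hδ, -, h⟩ := modulus ε hε
    refine (hap δ hδ).mono fun τ hτ z => ?_
    obtain ⟨σ, hσ⟩ := IsAlmostPeriodOfMultipleSet.exists_perm hτ
    rw [hconv, hconv, norm_sub_rev, ← σ.tsum_eq fun n => φ (a n - (z - τ))]
    refine h z _ fun n => ?_
    rw [show a (σ n) - (z - τ) = a (σ n) + τ - z by abel, dist_sub_right]
    exact (hσ n).le

/-! ### Plateau functions -/

/-- The radial test function equal to `1` on the closed ball of radius `r` about the origin and to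
`0` off the open ball of radius `2 r`, linear in the norm in between. -/
noncomputable def plateau {E : Type*} [Norm E] (r : ℝ) (x : E) : ℝ :=
  max 0 (min 1 (2 - ‖x‖ / r))

section plateau

variable {E : Type*} [NormedAddCommGroup E] {r : ℝ} {x : E}

lemma plateau_nonneg : 0 ≤ plateau r x := le_max_left _ _

lemma plateau_le_one : plateau r x ≤ 1 := max_le zero_le_one (min_le_left _ _)

lemma plateau_eq_one (hr : 0 < r) (hx : ‖x‖ ≤ r) : plateau r x = 1 := by
  have : ‖x‖ / r ≤ 1 := (div_le_one hr).2 hx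
  rw [plateau, min_eq_left (by linarith), max_eq_right zero_le_one]

lemma plateau_eq_zero (hr : 0 < r) (hx : 2 * r ≤ ‖x‖) : plateau r x = 0 := by
  have : 2 ≤ ‖x‖ / r := (le_div_iff₀ hr).2 hx
  exact max_eq_left ((min_le_right _ _).trans (by linarith))

lemma continuous_plateau : Continuous (plateau r : E → ℝ) := by
  unfold plateau
  fun_prop

lemma hasCompactSupport_plateau [ProperSpace E] (hr : 0 < r) :
    HasCompactSupport (plateau r : E → ℝ) :=
  HasCompactSupport.intro (isCompact_closedBall 0 (2 * r)) fun x hx =>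
    plateau_eq_zero hr (by simpa using le_of_lt (by simpa using hx))

end plateau

/-- The sum of the plateau function of radius `r` about `z` over the points of a multiple set lies
between the numbers of points at distance at most `r`, respectively less than `2 r`, from `z`. -/
lemma ncard_le_tsum_plateau_le_ncard {E : Type*} [NormedAddCommGroup E] {a : ℕ → E} {z : E} {r : ℝ}
    (hr : 0 < r) (hfin : {n | dist (a n) z < 2 * r}.Finite) :
    ({n | dist (a n) z ≤ r}.ncard : ℝ) ≤ ∑' n, plateau r (a n - z) ∧
      ∑' n, plateau r (a n - z) ≤ {n | dist (a n) z < 2 * r}.ncard := by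
  have hsub : {n | dist (a n) z ≤ r} ⊆ {n | dist (a n) z < 2 * r} :=
    fun n hn => by
    rw [Set.mem_ofPred_eq] at hn ⊢
    linarith
  have hfin' := hfin.subset hsub
  rw [tsum_eq_sum (s := hfin.toFinset) fun n hn => plateau_eq_zero hr (by
    simpa [dist_eq_norm] using hn), Set.ncard_eq_toFinset_card _ hfin,
    Set.ncard_eq_toFinset_card _ hfin', Finset.cast_card, Finset.cast_card]
  constructor
  · calc ∑ n ∈ hfin'.toFinset, (1 : ℝ) = ∑ n ∈ hfin'.toFinset, plateau r (a n - z) :=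
          Finset.sum_congr rfl fun n hn => (plateau_eq_one hr (by
            simpa [dist_eq_norm] using hn)).symm
      _ ≤ _ := Finset.sum_le_sum_of_subset_of_nonneg (by simpa using hsub)
          fun _ _ _ => plateau_nonneg
  · exact Finset.sum_le_sum fun _ _ => plateau_le_one

lemma measureConvolution_plateau {k : ℕ} {a : ℕ → EuclideanSpace ℝ (Fin k)}
    (ha : IsDiscreteMultipleSet a) {r : ℝ} (hr : 0 < r) (z : EuclideanSpace ℝ (Fin k)) :
    measureConvolution (fun x => (plateau r x : ℂ)) (countingMeasure a) z =
      ((∑' n, plateau r (a n - z) : ℝ) : ℂ) := by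
  rw [Complex.ofReal_tsum]
  exact ha.measureConvolution_eq_tsum (Complex.continuous_ofReal.comp continuous_plateau)
    ((hasCompactSupport_plateau hr).comp_left Complex.ofReal_zero) z

lemma IsAlmostPeriodicMeasure.isAlmostPeriodicMap_plateau {k : ℕ} {a : ℕ → EuclideanSpace ℝ (Fin k)}
    (hμ : IsAlmostPeriodicMeasure (countingMeasure a)) {r : ℝ} (hr : 0 < r) :
    IsAlmostPeriodicMap (measureConvolution (fun x => (plateau r x : ℂ)) (countingMeasure a)) :=
  hμ.2 _ (Complex.continuous_ofReal.comp continuous_plateau)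
    ((hasCompactSupport_plateau hr).comp_left Complex.ofReal_zero)

lemma IsAlmostPeriodicMeasure.exists_encard_le {k : ℕ} {a : ℕ → EuclideanSpace ℝ (Fin k)}
    (ha : IsDiscreteMultipleSet a) (hμ : IsAlmostPeriodicMeasure (countingMeasure a))
    {r : ℝ} (hr : 0 < r) : ∃ M : ℕ, ∀ c, {n | dist (a n) c ≤ r}.encard ≤ M := by
  obtain ⟨C, hC⟩ := (hμ.isAlmostPeriodicMap_plateau hr).exists_norm_le
  obtain ⟨M, hM⟩ := exists_nat_ge C
  refine ⟨M, fun c => ?_⟩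
  have h1 := (ncard_le_tsum_plateau_le_ncard hr (ha.finite_dist_lt c (2 * r))).1
  have h2 := hC c
  rw [measureConvolution_plateau ha hr, Complex.norm_real] at h2
  have h3 : ({n | dist (a n) c ≤ r}.ncard : ℝ) ≤ M :=
    h1.trans ((le_abs_self _).trans (h2.trans hM))
  rw [← (ha.finite_dist_le c r).cast_ncard_eq]
  exact_mod_cast h3

/-- An almost period, to within `1`, of the convolution with the plateau function of radius `r`
loses no points: the counts are integers, so a discrepancy below `1` is none. -/
lemma IsAlmostPeriodOfMap.ncard_le_ncard_add {k : ℕ} {a : ℕ → EuclideanSpace ℝ (Fin k)}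
    (ha : IsDiscreteMultipleSet a) {r : ℝ} (hr : 0 < r) {τ : EuclideanSpace ℝ (Fin k)}
    (hτ : IsAlmostPeriodOfMap
      (measureConvolution (fun x => (plateau r x : ℂ)) (countingMeasure a)) 1 τ)
    (z : EuclideanSpace ℝ (Fin k)) :
    {n | dist (a n) z ≤ r}.ncard ≤ {n | dist (a n + τ) z < 2 * r}.ncard := by
  have h1 := (ncard_le_tsum_plateau_le_ncard hr (ha.finite_dist_lt z (2 * r))).1
  have h2 := (ncard_le_tsum_plateau_le_ncard hr (ha.finite_dist_lt (z - τ) (2 * r))).2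
  have h3 := hτ z
  rw [measureConvolution_plateau ha hr, measureConvolution_plateau ha hr, ← Complex.ofReal_sub,
    Complex.norm_real] at h3
  have h4 := (abs_lt.1 h3).1
  have hset : {n | dist (a n + τ) z < 2 * r} = {n | dist (a n) (z - τ) < 2 * r} := by
    ext n
    simp only [Set.mem_ofPred_eq, dist_eq_norm, sub_sub_eq_add_sub]
  rw [hset]
  have : ({n | dist (a n) z ≤ r}.ncard : ℝ) < {n | dist (a n) (z - τ) < 2 * r}.ncard + 1 := by
    linarith
  exact Nat.lt_succ_iff.1 (by exact_mod_cast this)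

/-! ### Matching by Hall's theorem -/

/-- A point with at most `M` indices within distance `ε` has, among the `M + 1` disjoint annuli
`ε / 4 ^ (j + 1) < ‖·‖ < ε / 4 ^ j` about it, one that is free of points. -/
lemma exists_empty_annulus {E : Type*} [PseudoMetricSpace E] {a : ℕ → E} {ε : ℝ} (hε : 0 < ε)
    {M : ℕ} {z : E} (hM : {n | dist (a n) z ≤ ε}.encard ≤ M) :
    ∃ j : Fin (M + 1), ∀ m, dist (a m) z < 4 * (ε / 4 ^ (j.1 + 1)) →
      dist (a m) z ≤ ε / 4 ^ (j.1 + 1) := by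
  by_contra! h
  choose m hm1 hm2 using h
  have h4 : ∀ j : ℕ, 4 * (ε / 4 ^ (j + 1)) = ε / 4 ^ j := fun j => by
    rw [pow_succ]; field_simp
  have hanti : ∀ i j : ℕ, i ≤ j → ε / 4 ^ j ≤ ε / 4 ^ i := fun i j hij =>
    div_le_div_of_nonneg_left hε.le (by positivity) (pow_le_pow_right₀ (by norm_num) hij)
  have hlt : ∀ i j : Fin (M + 1), i < j → dist (a (m j)) z < dist (a (m i)) z := fun i j hij =>
    ((hm1 j).trans_le ((h4 j).trans_le (hanti _ _ hij))).trans (hm2 i)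
  have hinj : Function.Injective m := fun i j hij => by
    rcases lt_trichotomy i j with h | h | h
    · exact absurd (hlt i j h) (by rw [hij]; exact lt_irrefl _)
    · exact h
    · exact absurd (hlt j i h) (by rw [hij]; exact lt_irrefl _)
  have hsub : Set.range m ⊆ {n | dist (a n) z ≤ ε} := by
    rintro _ ⟨j, rfl⟩
    have := (hm1 j).trans_le ((h4 j).trans_le (hanti 0 j (Nat.zero_le _)))
    simpa using this.le
  have hcard : (Set.range m).encard = (M + 1 : ℕ) := by
    rw [← Set.image_univ, hinj.encard_image, Set.encard_univ]
    simp
  have := (hcard.symm.trans_le (Set.encard_le_encard hsub)).trans hM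
  exact absurd (by exact_mod_cast this : M + 1 ≤ M) (by omega)

/-- A matching of `a` into `b` exists if every `a n` has a radius `r n` such that the annulus
`r n < ‖·‖ < 4 r n` about it contains no `a m`, and `b` has at least as many points within
`2 r n` of `a n` as `a` has within `r n`. -/
lemma exists_injective_dist_lt {E : Type*} [PseudoMetricSpace E] {a b : ℕ → E} {r : ℕ → ℝ}
    (hr : ∀ n, 0 < r n)
    (hfa : ∀ n, {m | dist (a m) (a n) ≤ r n}.Finite)
    (hfb : ∀ n, {m | dist (b m) (a n) < 2 * r n}.Finite)
    (hgap : ∀ n m, dist (a m) (a n) < 4 * r n → dist (a m) (a n) ≤ r n)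
    (hcount : ∀ n, {m | dist (a m) (a n) ≤ r n}.ncard ≤ {m | dist (b m) (a n) < 2 * r n}.ncard) :
    ∃ f : ℕ → ℕ, Function.Injective f ∧ ∀ n, dist (b (f n)) (a n) < 2 * r n := by
  classical
  suffices hall : ∀ s : Finset ℕ, s.card ≤ (s.biUnion fun n => (hfb n).toFinset).card by
    obtain ⟨f, hf, hft⟩ := (Finset.all_card_le_biUnion_card_iff_exists_injective _).1 hall
    exact ⟨f, hf, fun n => by simpa using hft n⟩
  intro s
  induction s using Finset.strongInduction with
  | H s ih =>
    rcases s.eq_empty_or_nonempty with rfl | hs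
    · simp
    -- The cluster of largest radius is removed first: the points left over have neighbourhoods
    -- disjoint from its own.
    obtain ⟨n, hn, hmax⟩ := s.exists_max_image r hs
    let s' := s.filter fun m => r n < dist (a m) (a n)
    have hs' : s' ⊂ s := Finset.filter_ssubset.2 ⟨n, hn, by simpa using (hr n).le⟩
    have hcov : s ⊆ (hfa n).toFinset ∪ s' := fun m hm => by
      by_cases h : dist (a m) (a n) ≤ r n
      · simp [h]
      · simp [s', hm, not_le.1 h]
    have hdisj : Disjoint (hfb n).toFinset (s'.biUnion fun m => (hfb m).toFinset) := by
      rw [Finset.disjoint_left]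
      intro i hi hi'
      obtain ⟨m, hm, him⟩ := Finset.mem_biUnion.1 hi'
      rw [Set.Finite.mem_toFinset, Set.mem_ofPred_eq] at hi him
      obtain ⟨hms, hmn⟩ := Finset.mem_filter.1 hm
      have h1 : 4 * r n ≤ dist (a m) (a n) := by
        by_contra! h
        exact (hgap n m h).not_gt hmn
      have h2 := hmax m hms
      have h3 := dist_triangle_left (a m) (a n) (b i)
      linarith
    have hsub : (hfb n).toFinset ∪ (s'.biUnion fun m => (hfb m).toFinset) ⊆
        s.biUnion fun m => (hfb m).toFinset :=
      Finset.union_subset (Finset.subset_biUnion_of_mem (fun m => (hfb m).toFinset) hn)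
        (Finset.biUnion_subset_biUnion_of_subset_left _ hs'.subset)
    have hc := hcount n
    rw [Set.ncard_eq_toFinset_card _ (hfa n), Set.ncard_eq_toFinset_card _ (hfb n)] at hc
    calc s.card ≤ ((hfa n).toFinset ∪ s').card := Finset.card_le_card hcov
      _ ≤ (hfa n).toFinset.card + s'.card := Finset.card_union_le _ _
      _ ≤ (hfb n).toFinset.card + (s'.biUnion fun m => (hfb m).toFinset).card :=
        Nat.add_le_add hc (ih s' hs')
      _ = _ := (Finset.card_union_of_disjoint hdisj).symm
      _ ≤ _ := Finset.card_le_card hsub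

theorem IsAlmostPeriodicMeasure.isAlmostPeriodicMultipleSet {k : ℕ}
    {a : ℕ → EuclideanSpace ℝ (Fin k)} (ha : IsDiscreteMultipleSet a)
    (hμ : IsAlmostPeriodicMeasure (countingMeasure a)) : IsAlmostPeriodicMultipleSet a := by
  intro ε hε
  obtain ⟨M, hM⟩ := hμ.exists_encard_le ha hε
  let ρ : Fin (M + 1) → ℝ := fun j => ε / 4 ^ (j.1 + 1)
  have hρ : ∀ j, 0 < ρ j := fun j => by positivity
  have hρε : ∀ j, 2 * ρ j ≤ ε / 2 := fun j => by
    have : ρ j ≤ ε / 4 := div_le_div_of_nonneg_left hε.le (by norm_num)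
      (le_self_pow₀ (by norm_num) (Nat.succ_ne_zero _))
    linarith
  choose j hj using fun n => exists_empty_annulus hε (hM (a n))
  refine (relativelyDense_common_almostPeriods
    (fun i => hμ.isAlmostPeriodicMap_plateau (hρ i)) one_pos).mono fun τ hτ => ?_
  have inject : ∀ t, (∀ i, IsAlmostPeriodOfMap
      (measureConvolution (fun x => (plateau (ρ i) x : ℂ)) (countingMeasure a)) 1 t) →
      ∃ f : ℕ → ℕ, Function.Injective f ∧ ∀ n, dist (a (f n) + t) (a n) < ε / 2 := by
    intro t ht
    obtain ⟨f, hf, hft⟩ := exists_injective_dist_lt (a := a) (b := fun n => a n + t)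
      (r := fun n => ρ (j n)) (fun n => hρ _) (fun n => ha.finite_dist_le _ _)
      (fun n => (ha.finite_dist_lt (a n - t) (2 * ρ (j n))).subset fun m hm => by
        simpa only [Set.mem_ofPred_eq, dist_eq_norm, sub_sub_eq_add_sub] using hm)
      hj (fun n => (ht (j n)).ncard_le_ncard_add ha (hρ _) (a n))
    exact ⟨f, hf, fun n => (hft n).trans_le (hρε _)⟩
  obtain ⟨f, hf, hfτ⟩ := inject τ hτ
  obtain ⟨g, hg, hgτ⟩ := inject (-τ) fun i => (hτ i).neg
  obtain ⟨h, hh, hhτ⟩ := Function.Embedding.schroeder_bernstein_of_rel hf hg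
    (fun n m => dist (a n) (a m + τ) ≤ ε / 2)
    (fun n => by rw [dist_comm]; exact (hfτ n).le)
    (fun n => by
      have := (hgτ n).le
      rwa [← sub_eq_add_neg, dist_eq_norm, sub_sub, add_comm τ, ← dist_eq_norm] at this)
  exact isAlmostPeriodOfMultipleSet_of_perm hε (half_lt_self hε) (Equiv.ofBijective h hh) hhτ

theorem theorem11 (k : ℕ) (a : ℕ → EuclideanSpace ℝ (Fin k)) (ha : IsDiscreteMultipleSet a) :
    IsAlmostPeriodicMultipleSet a ↔ IsAlmostPeriodicMeasure (countingMeasure a) :=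
  ⟨fun h => h.isAlmostPeriodicMeasure ha, fun h => h.isAlmostPeriodicMultipleSet ha⟩
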